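/- For $H\in(0,1)$ let $B_H=\{B_H(t):t\ge 0\}$ be fractional Brownian motion with Hurst parameter $H$, i.e. a centered Gaussian process with almost surely continuous sample paths and $$\operatorname{Cov}(B_H(s),B_H(t))=\tfrac12\left(|s|^{2H}+|t|^{2H}-|s-t|^{2H}\right),\qquad s,t\ge 0 .$$ For $a\in\mathbb R$ and $T\in[0,\infty]$ put $$\mathscr P_H(T,a):=\mathbb E\left[\exp\left(\sup_{t\in[0,T]}\left(\sqrt2\,B_H(t)-a\,t^{2H}\right)\right)\right]\in[0,\infty],$$ where for $T=\infty$ the supremum is taken over $[0,\infty)$; for $a>1$ the number $\mathscr P_H(\infty,a)$ is called a Piterbarg constant. Let $0<H_1<H_2<1$. (i) For all $a\in\mathbb R$ and $T\in(0,\infty)$, $$\mathscr P_{H_2}(T,a)\le\mathscr P_{H_1}\left(T^{H_2/H_1},a\right)<\infty .$$ (ii) For all $a>1$, $$\mathscr P_{H_2}(\infty,a)\le\mathscr P_{H_1}(\infty,a)<\infty .$$ In particular, for every $a>1$ the Piterbarg constant $\mathscr P_H(\infty,a)$ is non-increasing in $H\in(0,1)$. -/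

import Mathlib

open MeasureTheory ProbabilityTheory
open scoped NNReal ENNReal

/-- `B` is a fractional Brownian motion with Hurst parameter `H` on the probability space
`(Ω, P)`: a centered Gaussian process indexed by `[0, ∞)`, with almost surely continuous sample
paths and `Cov(B s, B t) = (|s|^(2H) + |t|^(2H) - |s - t|^(2H)) / 2`. -/
structure IsFractionalBrownianMotion {Ω : Type*} [MeasurableSpace Ω] (P : Measure Ω)
    (H : ℝ) (B : ℝ≥0 → Ω → ℝ) : Prop where
  isGaussianProcess : IsGaussianProcess B P
  centered : ∀ t, ∫ ω, B t ω ∂P = 0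
  covariance_eq : ∀ s t, covariance (B s) (B t) P =
    (1 / 2 : ℝ) * (|(s : ℝ)| ^ (2 * H) + |(t : ℝ)| ^ (2 * H) - |(s : ℝ) - (t : ℝ)| ^ (2 * H))
  continuous_paths : ∀ᵐ ω ∂P, Continuous fun t => B t ω

/-- The supremum of `√2 * B t - a * t ^ (2H)` over all real `t ≥ 0` with `t ≤ T`, as an
extended real number. For `T = ∞` the supremum is over `[0, ∞)`. -/
noncomputable def supDrifted {Ω : Type*} (H : ℝ) (B : ℝ≥0 → Ω → ℝ) (T : ℝ≥0∞) (a : ℝ)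
    (ω : Ω) : EReal :=
  ⨆ (t : ℝ≥0) (_ : (t : ℝ≥0∞) ≤ T), ((√2 * B t ω - a * (t : ℝ) ^ (2 * H) : ℝ) : EReal)

/-- The functional `𝒫_H(T, a) = 𝔼 [exp (sup_{t ∈ [0, T]} (√2 * B_H(t) - a * t ^ (2H)))]`,
computed from a realization `B` of fractional Brownian motion, for `T ∈ [0, ∞]`. It is the
expectation of a nonnegative random variable, hence takes values in `[0, ∞]`. -/
noncomputable def piterbargFunctional {Ω : Type*} [MeasurableSpace Ω] (P : Measure Ω)
    (H : ℝ) (B : ℝ≥0 → Ω → ℝ) (T : ℝ≥0∞) (a : ℝ) : ℝ≥0∞ :=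
  ∫⁻ ω, EReal.exp (supDrifted H B T a ω) ∂P

/-! Put `h = H₂ / H₁ ≥ 1` and compare `B₂ t` with the time-changed process `B₁ (t ^ h)`. Both have
variance `t ^ (2 * H₂)`, and the time change turns the drift `a * t ^ (2 * H₁)` into `a * t ^ (2 *
H₂)`. Superadditivity of `x ↦ x ^ h` gives `|s - t| ^ (2 * H₂) ≤ |s ^ h - t ^ h| ^ (2 * H₁)`, so the
time-changed process has the smaller covariances. By Slepian's inequality
(`measure_forall_le_le_of_cov_le`) its maximum over any finite set is stochastically larger, even
after subtracting the common drift. Exponential moments are therefore ordered, and path continuity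
with monotone convergence passes to the full supremum (`piterbargFunctional_le`).

Slepian's inequality is proved by rotating one Gaussian vector into an independent copy of the
other; the sign of the derivative comes from Gaussian integration by parts.

Finiteness for `a > 1` is a separate argument. On `[k, k + 1]` the process is its value at `k` plus
an increment whose exponential moments are bounded uniformly in `k` by dyadic chaining. Part of the
drift beats the exponential moment of the value at `k`, and the surplus makes the sum over `k`
converge. A finite horizon reduces to the infinite one. -/

/-! ### Gaussian integration by parts. -/

theorem hasDerivAt_gaussianPDFReal_zero {v : ℝ≥0} (hv : v ≠ 0) (x : ℝ) :
    HasDerivAt (gaussianPDFReal 0 v) (-(x / v) * gaussianPDFReal 0 v x) x := by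
  have hv' : (v : ℝ) ≠ 0 := by exact_mod_cast hv
  have h1 : HasDerivAt (fun x : ℝ => -(x - 0) ^ 2 / (2 * (v : ℝ))) (-(x / v)) x := by
    have := ((((hasDerivAt_id x).sub_const 0).pow 2).neg).div_const (2 * (v : ℝ))
    refine this.congr_deriv ?_
    simp
    field_simp
  have h2 := h1.exp.const_mul ((√(2 * Real.pi * v))⁻¹)
  rw [gaussianPDFReal_def]
  refine h2.congr_deriv ?_
  ring

theorem integrable_gaussianReal_iff {v : ℝ≥0} (hv : v ≠ 0) (m : ℝ) (f : ℝ → ℝ) :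
    Integrable f (gaussianReal m v) ↔ Integrable (fun x => gaussianPDFReal m v x * f x) := by
  rw [gaussianReal_of_var_ne_zero _ hv, integrable_withDensity_iff_integrable_smul'
    (measurable_gaussianPDF _ _) (ae_of_all _ fun _ => gaussianPDF_lt_top)]
  simp

/-- Gaussian integration by parts in dimension one (Stein's identity). -/
theorem integral_id_mul_gaussianReal {v : ℝ≥0} (hv : v ≠ 0) {f f' : ℝ → ℝ} {K : ℝ}
    (hf : ∀ x, HasDerivAt f (f' x) x) (hf' : Measurable f')
    (hK : ∀ x, |f x| ≤ K) (hK' : ∀ x, |f' x| ≤ K) :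
    ∫ x, x * f x ∂gaussianReal 0 v = v * ∫ x, f' x ∂gaussianReal 0 v := by
  have hv' : (v : ℝ) ≠ 0 := by exact_mod_cast hv
  have hfm : Measurable f :=
    (continuous_iff_continuousAt.2 fun x => (hf x).continuousAt).measurable
  have i1 : Integrable (fun x => x * f x) (gaussianReal 0 v) := by
    have : Integrable (fun x : ℝ => x) (gaussianReal 0 v) :=
      (memLp_id_gaussianReal' (μ := 0) (v := v) 1 (by simp)).integrable le_rfl
    exact this.mul_bdd hfm.aestronglyMeasurable (ae_of_all _ hK)
  have i2 : Integrable f (gaussianReal 0 v) :=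
    .of_bound hfm.aestronglyMeasurable K (ae_of_all _ hK)
  have i3 : Integrable f' (gaussianReal 0 v) :=
    .of_bound hf'.aestronglyMeasurable K (ae_of_all _ hK')
  rw [integrable_gaussianReal_iff hv] at i1 i2 i3
  have key := integral_mul_deriv_eq_deriv_mul_of_integrable (u := f) (u' := f')
    (v := gaussianPDFReal 0 v) (v' := fun x => -(x / v) * gaussianPDFReal 0 v x)
    (fun x _ => hf x) (fun x _ => hasDerivAt_gaussianPDFReal_zero hv x)
    ((i1.const_mul (-(v : ℝ)⁻¹)).congr (ae_of_all _ fun x => by simp; ring))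
    (i3.congr (ae_of_all _ fun x => by simp; ring))
    (i2.congr (ae_of_all _ fun x => by simp; ring))
  rw [integral_gaussianReal_eq_integral_smul hv, integral_gaussianReal_eq_integral_smul hv]
  have e1 : ∫ x, gaussianPDFReal 0 v x • (x * f x)
      = -v * ∫ x, f x * (-(x / v) * gaussianPDFReal 0 v x) := by
    rw [← integral_const_mul]
    congr 1; ext x; simp; field_simp
  rw [e1, key]
  simp [mul_comm]

/-- Gaussian integration by parts: for a jointly Gaussian pair `(U, Z)` with `U` centered,
`𝔼[U g(Z)]` is the expectation of the derivative of `g` in the direction `Cov(U, Z)`. -/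
theorem integral_mul_comp_of_hasGaussianLaw {Ω ι : Type*} [MeasurableSpace Ω] [Fintype ι]
    {P : Measure Ω} {U : Ω → ℝ} {Z : ι → Ω → ℝ}
    (hUZ : HasGaussianLaw (fun ω => (U ω, fun i => Z i ω)) P) (hU : ∫ ω, U ω ∂P = 0)
    {g g' : (ι → ℝ) → ℝ} {K : ℝ} (hg : Measurable g) (hg' : Measurable g')
    (hK : ∀ z, |g z| ≤ K) (hK' : ∀ z, |g' z| ≤ K)
    (hd : ∀ z, HasDerivAt (fun x : ℝ => g (z + x • fun i => cov[U, Z i; P])) (g' z) 0) :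
    ∫ ω, U ω * g (fun i => Z i ω) ∂P = ∫ ω, g' (fun i => Z i ω) ∂P := by
  have hP := hUZ.isProbabilityMeasure
  set b : ι → ℝ := fun i => cov[U, Z i; P] with hb
  have hUG := hUZ.fst
  have hZG (i) : HasGaussianLaw (Z i) P := hUZ.snd.eval i
  have hlaw := hUG.map_eq_gaussianReal
  rw [hU] at hlaw
  -- If `U` is degenerate, it has no density for Stein's identity, but the direction `b` vanishes
  -- and both sides are zero.
  by_cases hv : Var[U; P] = 0
  · have hU0 : U =ᵐ[P] 0 := by
      have := ae_eq_integral_of_variance_eq_zero hUG.memLp_two hv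
      filter_upwards [this] with ω hω using by simpa [hU] using hω
    have hb0 : b = 0 := by
      ext i
      rw [hb]
      simp only [covariance, hU]
      rw [integral_congr_ae (g := fun _ => 0)]
      · simp
      · filter_upwards [hU0] with ω hω
        simp [hω]
    have hg0 (z) : g' z = 0 := by
      have := hd z
      simp only [hb0, smul_zero, add_zero] at this
      exact this.unique (hasDerivAt_const _ _)
    simp only [hg0, integral_zero]
    rw [integral_congr_ae (g := fun _ => 0)]
    · simp
    · filter_upwards [hU0] with ω hω
      simp [hω]
  · have hv0 : 0 < Var[U; P] := lt_of_le_of_ne (variance_nonneg _ _) (Ne.symm hv)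
    set v : ℝ≥0 := Var[U; P].toNNReal with hvdef
    have hvv : (v : ℝ) = Var[U; P] := Real.coe_toNNReal _ hv0.le
    have hvne : v ≠ 0 := by
      intro h; rw [h] at hvv; simp at hvv; exact hv hvv.symm
    have hvR : (v : ℝ) ≠ 0 := by exact_mod_cast hvne
    -- Residual of the regression of `Z` on `U`: it is uncorrelated with `U`, hence independent by
    -- joint Gaussianity. As `Z = R + U • (b / v)`, Stein's identity applies in the variable `U`
    -- with `R` frozen.
    set R : ι → Ω → ℝ := fun i ω => Z i ω - (b i / v) * U ω with hR
    have hUR : HasGaussianLaw (fun ω => (fun _ : Unit => U ω, fun i => R i ω)) P := by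
      let A : ℝ × (ι → ℝ) →L[ℝ] (Unit → ℝ) × (ι → ℝ) :=
        (ContinuousLinearMap.pi fun _ => ContinuousLinearMap.fst ℝ ℝ (ι → ℝ)).prod
          (ContinuousLinearMap.pi fun i =>
            (ContinuousLinearMap.proj i).comp (ContinuousLinearMap.snd ℝ ℝ (ι → ℝ))
              - (b i / v) • ContinuousLinearMap.fst ℝ ℝ (ι → ℝ))
      have := hUZ.map_fun A
      refine this.congr (.of_forall fun ω => ?_)
      ext i <;> simp [A, hR]
    have hind := hUR.indepFun_of_covariance_eval (X := fun _ : Unit => U) (Y := R) (by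
      intro _ i
      have h2 : R i = Z i - fun ω => (b i / v) * U ω := rfl
      rw [h2, covariance_sub_right hUG.memLp_two (hZG i).memLp_two (hUG.memLp_two.const_mul _),
        covariance_const_mul_right, covariance_self hUG.aemeasurable, ← hvv]
      simp [hb]
      field_simp
      simp)
    have hind' : IndepFun U (fun ω i => R i ω) P :=
      hind.comp (φ := fun x : Unit → ℝ => x ()) (ψ := id) (by fun_prop) (by fun_prop)
    have hRm : AEMeasurable (fun ω i => R i ω) P := hUR.snd.aemeasurable
    have hprod := (indepFun_iff_map_prod_eq_prod_map_map hUG.aemeasurable hRm).1 hind'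
    have : IsProbabilityMeasure (P.map fun ω i => R i ω) := Measure.isProbabilityMeasure_map hRm
    have hZR (ω) : (fun i => Z i ω) = (fun i => R i ω) + U ω • fun i => b i / v := by
      ext i; simp [hR]; ring
    set c : ι → ℝ := fun i => b i / v with hc
    have hbc : b = (v : ℝ) • c := by ext i; simp [hc]; field_simp
    have hd' (r : ι → ℝ) (u : ℝ) :
        HasDerivAt (fun u : ℝ => g (r + u • c)) (g' (r + u • c) / v) u := by
      have h1 := hd (r + u • c)
      have h2 : HasDerivAt (fun y : ℝ => (y - u) / v) (1 / v) u :=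
        ((hasDerivAt_id u).sub_const u).div_const _
      have h3 : HasDerivAt (fun x : ℝ => g (r + u • c + x • b)) (g' (r + u • c))
        ((u - u) / v) := by simpa using h1
      have h4 := h3.comp u h2
      refine (h4.congr_deriv (by ring)).congr_of_eventuallyEq (.of_forall fun y => ?_)
      simp only [Function.comp]
      congr 1
      rw [hbc]
      ext i
      simp only [Pi.add_apply, Pi.smul_apply, smul_eq_mul]
      field_simp
      ring
    have m1 : Measurable fun p : ℝ × (ι → ℝ) => g (p.2 + p.1 • c) := by fun_prop
    have m2 : Measurable fun p : ℝ × (ι → ℝ) => g' (p.2 + p.1 • c) := by fun_prop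
    have m0 : Measurable fun p : ℝ × (ι → ℝ) => p.1 * g (p.2 + p.1 • c) := measurable_fst.mul m1
    have hpair : AEMeasurable (fun ω => (U ω, fun i => R i ω)) P := hUG.aemeasurable.prodMk hRm
    have hUint : Integrable (fun x : ℝ => x) (gaussianReal 0 v) :=
      (memLp_id_gaussianReal' (μ := 0) (v := v) 1 (by simp)).integrable le_rfl
    calc ∫ ω, U ω * g (fun i => Z i ω) ∂P
        = ∫ p, p.1 * g (p.2 + p.1 • c) ∂(P.map fun ω => (U ω, fun i => R i ω)) := by
          rw [integral_map hpair m0.aestronglyMeasurable]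
          simp_rw [hZR]
      _ = ∫ r, ∫ u, u * g (r + u • c) ∂gaussianReal 0 v ∂(P.map fun ω i => R i ω) := by
          rw [hprod, hlaw, integral_prod_symm]
          exact (hUint.comp_fst _).mul_bdd m1.aestronglyMeasurable (ae_of_all _ fun p => hK _)
      _ = ∫ r, ∫ u, g' (r + u • c) ∂gaussianReal 0 v ∂(P.map fun ω i => R i ω) := by
          congr 1; ext r
          rw [integral_id_mul_gaussianReal (K := max K (K / v)) hvne (hd' r) (by fun_prop)
            (fun x => (hK _).trans (le_max_left _ _))
            (fun x => by
              rw [abs_div, abs_of_nonneg v.coe_nonneg]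
              exact (div_le_div_of_nonneg_right (hK' _) v.coe_nonneg).trans (le_max_right _ _)),
            integral_div]
          field_simp
      _ = ∫ p, g' (p.2 + p.1 • c) ∂(P.map fun ω => (U ω, fun i => R i ω)) := by
          rw [hprod, hlaw, integral_prod_symm]
          exact .of_bound m2.aestronglyMeasurable K (ae_of_all _ fun p => hK' _)
      _ = ∫ ω, g' (fun i => Z i ω) ∂P := by
          rw [integral_map hpair m2.aestronglyMeasurable]
          simp_rw [hZR]

theorem abs_prod_le_one {ι : Type*} {s : Finset ι} {f : ι → ℝ} (h0 : ∀ i, 0 ≤ f i) (h1 : ∀ i, f i ≤ 1) :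
    |∏ i ∈ s, f i| ≤ 1 := by
  rw [abs_of_nonneg (Finset.prod_nonneg fun i _ => h0 i)]
  exact Finset.prod_le_one (fun i _ => h0 i) fun i _ => h1 i

/-! ### Gaussian interpolation for products of smooth decreasing functions. -/

section Slepian

variable {Ω ι : Type*} [MeasurableSpace Ω] [Fintype ι] [DecidableEq ι]

/-- Gaussian integration by parts for the partial derivatives of a product of decreasing
functions: the expectation is nonpositive if the covariances are. -/
theorem integral_mul_prod_erase_nonpos {P : Measure Ω} {U : Ω → ℝ} {Z : ι → Ω → ℝ}
    (hUZ : HasGaussianLaw (fun ω => (U ω, fun i => Z i ω)) P) (hU : ∫ ω, U ω ∂P = 0) (i : ι)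
    (hi : cov[U, Z i; P] = 0) (hj : ∀ j, cov[U, Z j; P] ≤ 0)
    {φ φ' : ι → ℝ → ℝ} {K : ℝ} (hφ : ∀ i x, HasDerivAt (φ i) (φ' i x) x)
    (hφ' : ∀ i, Measurable (φ' i)) (h0 : ∀ i x, 0 ≤ φ i x) (h1 : ∀ i x, φ i x ≤ 1)
    (hn : ∀ i x, φ' i x ≤ 0) (hK : ∀ i x, |φ' i x| ≤ K) :
    ∫ ω, U ω * (φ' i (Z i ω) * ∏ j ∈ Finset.univ.erase i, φ j (Z j ω)) ∂P ≤ 0 := by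
  have hφm (i) : Measurable (φ i) :=
    (continuous_iff_continuousAt.2 fun x => (hφ i x).continuousAt).measurable
  set b : ι → ℝ := fun j => cov[U, Z j; P] with hb
  have hK0 : 0 ≤ K := (abs_nonneg _).trans (hK i 0)
  -- Since `b i = 0`, the factor `φ' i` is constant along `b`, so no second derivative of `φ i`
  -- appears. Each summand is nonnegative, being a multiple of a product of two nonpositive factors,
  -- and the prefactor `φ' i` is nonpositive.
  set D : (ι → ℝ) → ℝ := fun z => φ' i (z i) * ∑ j ∈ Finset.univ.erase i,
    (∏ k ∈ (Finset.univ.erase i).erase j, φ k (z k)) * (φ' j (z j) * b j) with hD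
  have hDm : Measurable D := by fun_prop
  rw [integral_mul_comp_of_hasGaussianLaw (g := fun z => φ' i (z i) *
    ∏ j ∈ Finset.univ.erase i, φ j (z j)) (g' := D) (K := max K (K * ∑ j, K * |b j|)) hUZ hU
    (by fun_prop) hDm]
  · refine integral_nonpos fun ω => mul_nonpos_of_nonpos_of_nonneg (hn _ _) ?_
    exact Finset.sum_nonneg fun j _ => mul_nonneg (Finset.prod_nonneg fun k _ => h0 _ _)
      (mul_nonneg_of_nonpos_of_nonpos (hn _ _) (hj j))
  · intro z
    refine le_trans ?_ (le_max_left _ _)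
    rw [abs_mul]
    simpa using mul_le_mul (hK i (z i)) (abs_prod_le_one (s := Finset.univ.erase i)
      (fun j => h0 j (z j)) fun j => h1 j (z j)) (abs_nonneg _) hK0
  · intro z
    refine le_trans ?_ (le_max_right _ _)
    rw [hD, abs_mul]
    refine mul_le_mul (hK _ _) ?_ (abs_nonneg _) hK0
    refine (Finset.abs_sum_le_sum_abs _ _).trans ?_
    refine (Finset.sum_le_sum fun j _ => ?_).trans
      (Finset.sum_le_sum_of_subset_of_nonneg (Finset.subset_univ _) fun j _ _ => by positivity)
    rw [abs_mul, abs_mul]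
    have := mul_le_mul (abs_prod_le_one (s := (Finset.univ.erase i).erase j)
      (fun j => h0 j (z j)) fun j => h1 j (z j))
      (mul_le_mul_of_nonneg_right (hK j (z j)) (abs_nonneg (b j))) (by positivity) zero_le_one
    simpa using this
  · intro z
    have hl (j : ι) : HasDerivAt (fun x : ℝ => z j + x * b j) (b j) 0 := by
      simpa using ((hasDerivAt_id (0 : ℝ)).mul_const (b j)).const_add (z j)
    have hc (j : ι) : HasDerivAt (fun x : ℝ => φ j (z j + x * b j)) (φ' j (z j) * b j) 0 := by
      have := (hφ j (z j + 0 * b j)).comp (0 : ℝ) (hl j)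
      refine (this.congr_deriv (by simp)).congr_of_eventuallyEq (.of_forall fun x => rfl)
    have hp := (HasDerivAt.fun_finsetProd (u := Finset.univ.erase i) fun j _ => hc j).const_mul
      (φ' i (z i))
    have hbi : b i = 0 := hi
    simp only [zero_mul, add_zero, smul_eq_mul] at hp
    refine hp.congr_of_eventuallyEq (.of_forall fun x => ?_)
    change φ' i (z i + x * b i) * ∏ j ∈ Finset.univ.erase i, φ j (z j + x * b j) = _
    rw [hbi, mul_zero, add_zero]

variable {P : Measure Ω} {X Y : ι → Ω → ℝ}

/-- The path `Z θ = cos θ X + sin θ Y` runs from `X` at `0` to `Y` at `π / 2` with velocity `V θ`.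
The covariance of `V θ i` and `Z θ j` is `sin θ cos θ` times the covariance difference: nonpositive,
and zero for `j = i` because variances agree. Integration by parts then makes the expectation
antitone in `θ`. Trigonometric coefficients keep the velocity bounded up to the endpoints. -/
theorem integral_prod_comp_le_of_cov_zero
    (hXY : HasGaussianLaw (fun ω => (fun i => X i ω, fun i => Y i ω)) P)
    (hX0 : ∀ i, ∫ ω, X i ω ∂P = 0) (hY0 : ∀ i, ∫ ω, Y i ω ∂P = 0)
    (hind : ∀ i j, cov[X i, Y j; P] = 0)
    (hvar : ∀ i, cov[X i, X i; P] = cov[Y i, Y i; P])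
    (hcov : ∀ i j, cov[Y i, Y j; P] ≤ cov[X i, X j; P])
    {φ φ' : ι → ℝ → ℝ} {K : ℝ} (hφ : ∀ i x, HasDerivAt (φ i) (φ' i x) x)
    (hφ' : ∀ i, Measurable (φ' i)) (h0 : ∀ i x, 0 ≤ φ i x) (h1 : ∀ i x, φ i x ≤ 1)
    (hn : ∀ i x, φ' i x ≤ 0) (hK : ∀ i x, |φ' i x| ≤ K) :
    ∫ ω, ∏ i, φ i (Y i ω) ∂P ≤ ∫ ω, ∏ i, φ i (X i ω) ∂P := by
  have hP := hXY.isProbabilityMeasure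
  have hφm (i) : Measurable (φ i) :=
    (continuous_iff_continuousAt.2 fun x => (hφ i x).continuousAt).measurable
  have hXG (i) : HasGaussianLaw (X i) P := hXY.fst.eval i
  have hYG (i) : HasGaussianLaw (Y i) P := hXY.snd.eval i
  have hXm (i) := (hXG i).aemeasurable
  have hYm (i) := (hYG i).aemeasurable
  set Z : ℝ → ι → Ω → ℝ := fun θ i ω => Real.cos θ * X i ω + Real.sin θ * Y i ω with hZ
  set V : ℝ → ι → Ω → ℝ := fun θ i ω => -Real.sin θ * X i ω + Real.cos θ * Y i ω with hV
  have hZm (θ i) : AEMeasurable (Z θ i) P := by fun_prop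
  have hVm (θ i) : AEMeasurable (V θ i) P := by fun_prop
  set D : ℝ → Ω → ℝ := fun θ ω => ∑ i, V θ i ω *
    (φ' i (Z θ i ω) * ∏ j ∈ Finset.univ.erase i, φ j (Z θ j ω)) with hD
  have hVZ (θ i) : HasGaussianLaw (fun ω => (V θ i ω, fun j => Z θ j ω)) P := by
    let px (j : ι) : (ι → ℝ) × (ι → ℝ) →L[ℝ] ℝ :=
      (ContinuousLinearMap.proj j).comp (ContinuousLinearMap.fst ℝ (ι → ℝ) (ι → ℝ))
    let py (j : ι) : (ι → ℝ) × (ι → ℝ) →L[ℝ] ℝ :=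
      (ContinuousLinearMap.proj j).comp (ContinuousLinearMap.snd ℝ (ι → ℝ) (ι → ℝ))
    let A : (ι → ℝ) × (ι → ℝ) →L[ℝ] ℝ × (ι → ℝ) :=
      (-Real.sin θ • px i + Real.cos θ • py i).prod
        (ContinuousLinearMap.pi fun j => Real.cos θ • px j + Real.sin θ • py j)
    refine (hXY.map_fun A).congr (.of_forall fun ω => ?_)
    ext <;> simp [A, px, py, hV, hZ]
  have hV0 (θ i) : ∫ ω, V θ i ω ∂P = 0 := by
    simp only [hV]
    rw [integral_add ((hXG i).integrable.const_mul _) ((hYG i).integrable.const_mul _),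
      integral_const_mul, integral_const_mul, hX0, hY0]
    simp
  have hVcov (θ i j) : cov[V θ i, Z θ j; P]
      = Real.sin θ * Real.cos θ * (cov[Y i, Y j; P] - cov[X i, X j; P]) := by
    have e1 : V θ i = (fun ω => -Real.sin θ * X i ω) + fun ω => Real.cos θ * Y i ω := rfl
    have e2 : Z θ j = (fun ω => Real.cos θ * X j ω) + fun ω => Real.sin θ * Y j ω := rfl
    have mX (i) (c : ℝ) : MemLp (fun ω => c * X i ω) 2 P := (hXG i).memLp_two.const_mul _
    have mY (i) (c : ℝ) : MemLp (fun ω => c * Y i ω) 2 P := (hYG i).memLp_two.const_mul _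
    rw [e1, e2, covariance_add_left (mX _ _) (mY _ _) ((mX _ _).add (mY _ _)),
      covariance_add_right (mX _ _) (mX _ _) (mY _ _),
      covariance_add_right (mY _ _) (mX _ _) (mY _ _)]
    simp only [covariance_const_mul_left, covariance_const_mul_right, hind,
      covariance_comm (Y i) (X j)]
    ring
  have hDle (θ ω) : ‖D θ ω‖ ≤ ∑ i, (|X i ω| + |Y i ω|) * K := by
    rw [Real.norm_eq_abs]
    refine (Finset.abs_sum_le_sum_abs _ _).trans (Finset.sum_le_sum fun i _ => ?_)
    rw [abs_mul]
    refine mul_le_mul ?_ ?_ (abs_nonneg _) (by positivity)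
    · refine (abs_add_le _ _).trans (add_le_add ?_ ?_)
      · rw [abs_mul, abs_neg]
        exact mul_le_of_le_one_left (abs_nonneg _) (Real.abs_sin_le_one _)
      · rw [abs_mul]
        exact mul_le_of_le_one_left (abs_nonneg _) (Real.abs_cos_le_one _)
    · rw [abs_mul]
      simpa using mul_le_mul (hK i (Z θ i ω)) (abs_prod_le_one (s := Finset.univ.erase i)
        (fun j => h0 j (Z θ j ω)) fun j => h1 j (Z θ j ω)) (abs_nonneg _)
        ((abs_nonneg _).trans (hK i 0))
  have hprodm (θ) : AEStronglyMeasurable (fun ω => ∏ i, φ i (Z θ i ω)) P := by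
    refine AEMeasurable.aestronglyMeasurable ?_
    exact Finset.aemeasurable_fun_prod _ fun i _ => (hφm i).comp_aemeasurable (hZm θ i)
  have hterm (θ i) : AEMeasurable (fun ω => V θ i ω *
      (φ' i (Z θ i ω) * ∏ j ∈ Finset.univ.erase i, φ j (Z θ j ω))) P :=
    (hVm θ i).mul (((hφ' i).comp_aemeasurable (hZm θ i)).mul
      (Finset.aemeasurable_fun_prod _ fun j _ => (hφm j).comp_aemeasurable (hZm θ j)))
  have hDm (θ) : AEStronglyMeasurable (D θ) P :=
    (Finset.aemeasurable_fun_sum _ fun i _ => hterm θ i).aestronglyMeasurable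
  have hderiv (θ : ℝ) : HasDerivAt (fun θ => ∫ ω, ∏ i, φ i (Z θ i ω) ∂P) (∫ ω, D θ ω ∂P) θ := by
    refine (hasDerivAt_integral_of_dominated_loc_of_deriv_le (s := Set.univ) (F' := D)
      (bound := fun ω => ∑ i, (|X i ω| + |Y i ω|) * K)
      Filter.univ_mem (.of_forall hprodm) ?_ (hDm θ) (ae_of_all _ fun ω θ _ => hDle θ ω) ?_
      (ae_of_all _ fun ω θ _ => ?_)).2
    · exact .of_bound (hprodm θ) 1 (ae_of_all _ fun ω =>
        abs_prod_le_one (fun i => h0 _ _) fun i => h1 _ _)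
    · exact integrable_finsetSum _ fun i _ =>
        ((hXG i).integrable.abs.add (hYG i).integrable.abs).mul_const K
    · have hc (i : ι) : HasDerivAt (fun θ => φ i (Z θ i ω)) (φ' i (Z θ i ω) * V θ i ω) θ := by
        have hz : HasDerivAt (fun θ => Z θ i ω) (V θ i ω) θ :=
          ((Real.hasDerivAt_cos θ).mul_const (X i ω)).add
            ((Real.hasDerivAt_sin θ).mul_const (Y i ω))
        exact (hφ i (Z θ i ω)).comp θ hz
      refine (HasDerivAt.fun_finsetProd (u := Finset.univ) fun i _ => hc i).congr_deriv ?_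
      simp only [hD, smul_eq_mul]
      exact Finset.sum_congr rfl fun i _ => by ring
  have hanti : AntitoneOn (fun θ => ∫ ω, ∏ i, φ i (Z θ i ω) ∂P) (Set.Icc 0 (Real.pi / 2)) := by
    refine antitoneOn_of_deriv_nonpos (convex_Icc _ _)
      (fun θ _ => (hderiv θ).continuousAt.continuousWithinAt)
      (fun θ _ => (hderiv θ).differentiableAt.differentiableWithinAt) fun θ hθ => ?_
    rw [interior_Icc] at hθ
    rw [(hderiv θ).deriv]
    simp only [hD]
    have hsc : 0 ≤ Real.sin θ * Real.cos θ :=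
      mul_nonneg (Real.sin_nonneg_of_nonneg_of_le_pi hθ.1.le (by linarith [hθ.2, Real.pi_pos]))
        (Real.cos_nonneg_of_neg_pi_div_two_le_of_le (by linarith [hθ.1, Real.pi_pos]) hθ.2.le)
    rw [integral_finsetSum]
    · refine Finset.sum_nonpos fun i _ => ?_
      refine integral_mul_prod_erase_nonpos (hVZ θ i) (hV0 θ i) i ?_ ?_ hφ hφ' h0 h1 hn hK
      · rw [hVcov, hvar]; simp
      · intro j
        rw [hVcov]
        exact mul_nonpos_of_nonneg_of_nonpos hsc (sub_nonpos.2 (hcov i j))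
    · intro i _
      refine ((hVZ θ i).fst.integrable).mul_bdd (c := K) ?_ (ae_of_all _ fun ω => ?_)
      · exact (((hφ' i).comp_aemeasurable (hZm θ i)).mul
          (Finset.aemeasurable_fun_prod _ fun j _ =>
            (hφm j).comp_aemeasurable (hZm θ j))).aestronglyMeasurable
      · rw [Real.norm_eq_abs, abs_mul]
        simpa using mul_le_mul (hK i (Z θ i ω)) (abs_prod_le_one (s := Finset.univ.erase i)
          (fun j => h0 j (Z θ j ω)) fun j => h1 j (Z θ j ω)) (abs_nonneg _)
          ((abs_nonneg _).trans (hK i 0))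
  have := hanti (Set.left_mem_Icc.2 (by positivity)) (Set.right_mem_Icc.2 (by positivity))
    (by positivity)
  simpa [hZ] using this

end Slepian

/-! ### Slepian's inequality and exponential moments of finite maxima. -/

section Slepian

variable {Ω₁ Ω₂ ι : Type*} [MeasurableSpace Ω₁] [MeasurableSpace Ω₂] [Fintype ι]
  {P₁ : Measure Ω₁} {P₂ : Measure Ω₂} {X : ι → Ω₁ → ℝ} {Y : ι → Ω₂ → ℝ}

/-- Slepian's comparison inequality for products of smooth decreasing functions. -/
theorem integral_prod_comp_le
    (hX : HasGaussianLaw (fun ω i => X i ω) P₁) (hY : HasGaussianLaw (fun ω i => Y i ω) P₂)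
    (hX0 : ∀ i, ∫ ω, X i ω ∂P₁ = 0) (hY0 : ∀ i, ∫ ω, Y i ω ∂P₂ = 0)
    (hvar : ∀ i, cov[X i, X i; P₁] = cov[Y i, Y i; P₂])
    (hcov : ∀ i j, cov[Y i, Y j; P₂] ≤ cov[X i, X j; P₁])
    {φ φ' : ι → ℝ → ℝ} {K : ℝ} (hφ : ∀ i x, HasDerivAt (φ i) (φ' i x) x)
    (hφ' : ∀ i, Measurable (φ' i)) (h0 : ∀ i x, 0 ≤ φ i x) (h1 : ∀ i x, φ i x ≤ 1)
    (hn : ∀ i x, φ' i x ≤ 0) (hK : ∀ i x, |φ' i x| ≤ K) :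
    ∫ ω, ∏ i, φ i (Y i ω) ∂P₂ ≤ ∫ ω, ∏ i, φ i (X i ω) ∂P₁ := by
  classical
  have hP₁ := hX.isProbabilityMeasure
  have hP₂ := hY.isProbabilityMeasure
  -- Only the separate laws of `X` and `Y` matter, so both are moved to the product space, where
  -- they are independent.
  have m1 : MeasurePreserving Prod.fst (P₁.prod P₂) P₁ := measurePreserving_fst
  have m2 : MeasurePreserving Prod.snd (P₁.prod P₂) P₂ := measurePreserving_snd
  have hφm (i) : Measurable (φ i) :=
    (continuous_iff_continuousAt.2 fun x => (hφ i x).continuousAt).measurable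
  have hXm (i) : AEMeasurable (X i) P₁ := (hX.eval i).aemeasurable
  have hYm (i) : AEMeasurable (Y i) P₂ := (hY.eval i).aemeasurable
  have int1 {f : Ω₁ → ℝ} (hf : AEMeasurable f P₁) :
      ∫ ω, f ω.1 ∂P₁.prod P₂ = ∫ ω, f ω ∂P₁ := by
    rw [← m1.map_eq] at hf
    conv_rhs => rw [← m1.map_eq]
    rw [integral_map measurable_fst.aemeasurable hf.aestronglyMeasurable]
  have int2 {f : Ω₂ → ℝ} (hf : AEMeasurable f P₂) :
      ∫ ω, f ω.2 ∂P₁.prod P₂ = ∫ ω, f ω ∂P₂ := by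
    rw [← m2.map_eq] at hf
    conv_rhs => rw [← m2.map_eq]
    rw [integral_map measurable_snd.aemeasurable hf.aestronglyMeasurable]
  have hX' : HasGaussianLaw (fun ω : Ω₁ × Ω₂ => fun i => X i ω.1) (P₁.prod P₂) := by
    constructor
    have := hX.isGaussian_map
    rw [← m1.map_eq, AEMeasurable.map_map_of_aemeasurable] at this
    · exact this
    · rw [m1.map_eq]; exact hX.aemeasurable
    · exact measurable_fst.aemeasurable
  have hY' : HasGaussianLaw (fun ω : Ω₁ × Ω₂ => fun i => Y i ω.2) (P₁.prod P₂) := by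
    constructor
    have := hY.isGaussian_map
    rw [← m2.map_eq, AEMeasurable.map_map_of_aemeasurable] at this
    · exact this
    · rw [m2.map_eq]; exact hY.aemeasurable
    · exact measurable_snd.aemeasurable
  have hind : IndepFun (fun ω : Ω₁ × Ω₂ => fun i => X i ω.1)
      (fun ω : Ω₁ × Ω₂ => fun i => Y i ω.2) (P₁.prod P₂) :=
    indepFun_prod₀ hX.aemeasurable hY.aemeasurable
  have hXY := hind.hasGaussianLaw hX' hY'
  have c1 (i j) : cov[fun ω : Ω₁ × Ω₂ => X i ω.1, fun ω => X j ω.1; P₁.prod P₂]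
      = cov[X i, X j; P₁] := by
    simp only [covariance, int1 (hXm _)]
    exact int1 (f := fun ω => (X i ω - ∫ x, X i x ∂P₁) * (X j ω - ∫ x, X j x ∂P₁))
      (by fun_prop)
  have c2 (i j) : cov[fun ω : Ω₁ × Ω₂ => Y i ω.2, fun ω => Y j ω.2; P₁.prod P₂]
      = cov[Y i, Y j; P₂] := by
    simp only [covariance, int2 (hYm _)]
    exact int2 (f := fun ω => (Y i ω - ∫ x, Y i x ∂P₂) * (Y j ω - ∫ x, Y j x ∂P₂))
      (by fun_prop)
  have key := integral_prod_comp_le_of_cov_zero (P := P₁.prod P₂)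
    (X := fun i ω => X i ω.1) (Y := fun i ω => Y i ω.2) hXY
    (fun i => by rw [int1 (hXm i), hX0]) (fun i => by rw [int2 (hYm i), hY0])
    (fun i j => IndepFun.covariance_eq_zero
      (hind.comp (φ := fun x : ι → ℝ => x i) (ψ := fun x : ι → ℝ => x j) (by fun_prop) (by fun_prop))
      (hX'.eval i).memLp_two (hY'.eval j).memLp_two)
    (fun i => by rw [c1, c2, hvar]) (fun i j => by rw [c1, c2]; exact hcov i j)
    hφ hφ' h0 h1 hn hK
  rwa [int1 (f := fun ω => ∏ i, φ i (X i ω)) (Finset.aemeasurable_fun_prod _ fun i _ =>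
      (hφm i).comp_aemeasurable (hXm i)),
    int2 (f := fun ω => ∏ i, φ i (Y i ω)) (Finset.aemeasurable_fun_prod _ fun i _ =>
      (hφm i).comp_aemeasurable (hYm i))] at key

/-- The offset `n` makes the limit `1` at `x = c` as well, so that the closed half-line is
approximated; for `x > c` the term `n ^ 2 * (x - c)` dominates it. -/
theorem tendsto_sigmoid_indicator (c x : ℝ) :
    Filter.Tendsto (fun n : ℕ => Real.sigmoid (n - n ^ 2 * (x - c))) Filter.atTop
      (nhds ((Set.Iic c).indicator 1 x)) := by
  have hn : Filter.Tendsto (fun n : ℕ => (n : ℝ)) Filter.atTop Filter.atTop :=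
    tendsto_natCast_atTop_atTop
  by_cases hx : x ≤ c
  · rw [Set.indicator_of_mem (by exact hx)]
    refine Real.tendsto_sigmoid_atTop.comp (Filter.tendsto_atTop_mono (fun n => ?_) hn)
    nlinarith [mul_nonneg (sq_nonneg (n : ℝ)) (sub_nonneg.2 hx)]
  · rw [Set.indicator_of_notMem (by exact hx)]
    refine Real.tendsto_sigmoid_atBot.comp ?_
    have h1 : Filter.Tendsto (fun n : ℕ => 1 - (n : ℝ) * (x - c)) Filter.atTop Filter.atBot :=
      Filter.tendsto_atBot_add_const_left _ 1 (Filter.tendsto_neg_atTop_atBot.comp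
        (hn.atTop_mul_const (sub_pos.2 (not_le.1 hx))))
    refine (hn.atTop_mul_atBot₀ h1).congr fun n => by ring

theorem tendsto_integral_prod_sigmoid [IsFiniteMeasure P₁] (hX : ∀ i, AEMeasurable (X i) P₁)
    (c : ι → ℝ) :
    Filter.Tendsto (fun n : ℕ => ∫ ω, ∏ i, Real.sigmoid (n - n ^ 2 * (X i ω - c i)) ∂P₁)
      Filter.atTop (nhds (P₁.real {ω | ∀ i, X i ω ≤ c i})) := by
  have hs : NullMeasurableSet {ω | ∀ i, X i ω ≤ c i} P₁ := by
    rw [Set.ofPred_forall]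
    exact .iInter fun i => nullMeasurableSet_le (hX i) aemeasurable_const
  have e : P₁.real {ω | ∀ i, X i ω ≤ c i}
      = ∫ ω, ∏ i, (Set.Iic (c i)).indicator (1 : ℝ → ℝ) (X i ω) ∂P₁ := by
    rw [← setIntegral_one_eq_measureReal, ← integral_indicator₀ hs]
    congr 1; ext ω
    by_cases h : ∀ i, X i ω ≤ c i
    · rw [Set.indicator_of_mem (by exact h)]
      simp [Set.indicator, h]
    · rw [Set.indicator_of_notMem (by exact h)]
      push Not at h
      obtain ⟨i, hi⟩ := h
      exact (Finset.prod_eq_zero (Finset.mem_univ i)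
        (Set.indicator_of_notMem (s := Set.Iic (c i)) (by simpa using hi) _)).symm
  rw [e]
  refine tendsto_integral_of_dominated_convergence (fun _ => 1) (fun n => ?_)
    (integrable_const _) (fun n => ae_of_all _ fun ω => ?_) (ae_of_all _ fun ω => ?_)
  · refine (Finset.aemeasurable_fun_prod _ fun i _ => ?_).aestronglyMeasurable
    exact continuous_sigmoid.measurable.comp_aemeasurable
      (aemeasurable_const.sub (((hX i).sub_const _).const_mul _))
  · exact abs_prod_le_one (fun i => Real.sigmoid_nonneg _) fun i => Real.sigmoid_le_one _
  · exact tendsto_finsetProd _ fun i _ => tendsto_sigmoid_indicator _ _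

/-- **Slepian's inequality**. -/
theorem measure_forall_le_le_of_cov_le
    (hX : HasGaussianLaw (fun ω i => X i ω) P₁) (hY : HasGaussianLaw (fun ω i => Y i ω) P₂)
    (hX0 : ∀ i, ∫ ω, X i ω ∂P₁ = 0) (hY0 : ∀ i, ∫ ω, Y i ω ∂P₂ = 0)
    (hvar : ∀ i, cov[X i, X i; P₁] = cov[Y i, Y i; P₂])
    (hcov : ∀ i j, cov[Y i, Y j; P₂] ≤ cov[X i, X j; P₁]) (c : ι → ℝ) :
    P₂ {ω | ∀ i, Y i ω ≤ c i} ≤ P₁ {ω | ∀ i, X i ω ≤ c i} := by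
  have hP₁ := hX.isProbabilityMeasure
  have hP₂ := hY.isProbabilityMeasure
  refine (ENNReal.toReal_le_toReal (measure_ne_top _ _) (measure_ne_top _ _)).1 ?_
  refine le_of_tendsto_of_tendsto'
    (tendsto_integral_prod_sigmoid (fun i => (hY.eval i).aemeasurable) c)
    (tendsto_integral_prod_sigmoid (fun i => (hX.eval i).aemeasurable) c) fun n => ?_
  refine integral_prod_comp_le hX hY hX0 hY0 hvar hcov
    (φ := fun i x => Real.sigmoid (n - n ^ 2 * (x - c i)))
    (φ' := fun i x => Real.sigmoid (n - n ^ 2 * (x - c i)) *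
      (1 - Real.sigmoid (n - n ^ 2 * (x - c i))) * (-(n ^ 2))) (K := n ^ 2)
    (fun i x => ?_) (fun i => ?_) (fun i x => Real.sigmoid_nonneg _)
    (fun i x => Real.sigmoid_le_one _) (fun i x => ?_) fun i x => ?_
  · have h1 : HasDerivAt (fun x : ℝ => n - n ^ 2 * (x - c i)) (-(n ^ 2 : ℝ)) x := by
      simpa using (((hasDerivAt_id x).sub_const (c i)).const_mul ((n : ℝ) ^ 2)).const_sub (n : ℝ)
    exact (Real.hasDerivAt_sigmoid _).comp x h1
  · have := continuous_sigmoid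
    exact Continuous.measurable (by fun_prop)
  · exact mul_nonpos_of_nonneg_of_nonpos (mul_nonneg (Real.sigmoid_nonneg _)
      (sub_nonneg.2 (Real.sigmoid_le_one _))) (by simp)
  · have a0 := Real.sigmoid_nonneg (n - n ^ 2 * (x - c i))
    have a1 := Real.sigmoid_le_one (n - n ^ 2 * (x - c i))
    rw [abs_mul, abs_neg, abs_of_nonneg (by positivity : (0 : ℝ) ≤ (n : ℝ) ^ 2),
      abs_of_nonneg (mul_nonneg a0 (sub_nonneg.2 a1))]
    exact mul_le_of_le_one_left (by positivity) (mul_le_one₀ a1 (by linarith) (by linarith))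

/-- The layer-cake formula reduces exponential moments to the orthant probabilities that Slepian's
inequality compares; the drift `m` only shifts the thresholds. -/
theorem lintegral_iSup_exp_eq [IsProbabilityMeasure P₁] [Nonempty ι]
    (hX : ∀ i, AEMeasurable (X i) P₁) {l : ℝ} (hl : 0 < l) (m : ι → ℝ) :
    ∫⁻ ω, ⨆ i, ENNReal.ofReal (Real.exp (l * X i ω - m i)) ∂P₁
      = ∫⁻ t in Set.Ioi 0, (1 - P₁ {ω | ∀ i, X i ω ≤ (Real.log t + m i) / l}) := by
  have conv (f : ι → ℝ) : ⨆ i, ENNReal.ofReal (Real.exp (f i))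
      = ENNReal.ofReal (Finset.univ.sup' Finset.univ_nonempty fun i => Real.exp (f i)) := by
    refine le_antisymm (iSup_le fun i => ENNReal.ofReal_le_ofReal
      (Finset.le_sup' (fun i => Real.exp (f i)) (Finset.mem_univ i))) ?_
    obtain ⟨i, _, hi⟩ := Finset.exists_mem_eq_sup' Finset.univ_nonempty fun i => Real.exp (f i)
    rw [hi]
    exact le_iSup (fun i => ENNReal.ofReal (Real.exp (f i))) i
  have hset {t : ℝ} (ht : 0 < t) :
      {ω | t < Finset.univ.sup' Finset.univ_nonempty fun i => Real.exp (l * X i ω - m i)}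
        = {ω | ∀ i, X i ω ≤ (Real.log t + m i) / l}ᶜ := by
    ext ω
    simp only [Finset.lt_sup'_iff, Finset.mem_univ, true_and, Set.mem_ofPred_eq, Set.mem_compl_iff,
      not_forall, not_le]
    refine exists_congr fun i => ?_
    rw [← Real.log_lt_iff_lt_exp ht, div_lt_iff₀ hl, mul_comm, lt_sub_iff_add_lt]
  have hmeas : AEMeasurable (fun ω =>
      Finset.univ.sup' Finset.univ_nonempty fun i => Real.exp (l * X i ω - m i)) P₁ := by
    have : Measurable fun x : ι → ℝ =>
        Finset.univ.sup' Finset.univ_nonempty fun i => Real.exp (l * x i - m i) :=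
      (Continuous.finset_sup'_apply _ fun i _ => by fun_prop).measurable
    exact this.comp_aemeasurable (aemeasurable_pi_lambda _ hX)
  have hpos (ω) : 0 ≤ Finset.univ.sup' Finset.univ_nonempty fun i => Real.exp (l * X i ω - m i) :=
    (Real.exp_pos _).le.trans (Finset.le_sup' (fun i => Real.exp (l * X i ω - m i))
      (Finset.mem_univ (Classical.arbitrary ι)))
  simp_rw [conv]
  rw [lintegral_eq_lintegral_meas_lt _ (ae_of_all _ hpos) hmeas]
  refine setLIntegral_congr_fun measurableSet_Ioi fun t ht => ?_
  have hnull : NullMeasurableSet {ω | ∀ i, X i ω ≤ (Real.log t + m i) / l} P₁ := by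
    rw [Set.ofPred_forall]
    exact .iInter fun i => nullMeasurableSet_le (hX i) aemeasurable_const
  rw [hset ht, prob_compl_eq_one_sub₀ hnull]

/-- Comparison of the exponential moments of the maxima of two finite Gaussian families. -/
theorem lintegral_iSup_exp_le_of_cov_le
    (hX : HasGaussianLaw (fun ω i => X i ω) P₁) (hY : HasGaussianLaw (fun ω i => Y i ω) P₂)
    (hX0 : ∀ i, ∫ ω, X i ω ∂P₁ = 0) (hY0 : ∀ i, ∫ ω, Y i ω ∂P₂ = 0)
    (hvar : ∀ i, cov[X i, X i; P₁] = cov[Y i, Y i; P₂])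
    (hcov : ∀ i j, cov[Y i, Y j; P₂] ≤ cov[X i, X j; P₁]) {l : ℝ} (hl : 0 < l) (m : ι → ℝ) :
    ∫⁻ ω, ⨆ i, ENNReal.ofReal (Real.exp (l * X i ω - m i)) ∂P₁
      ≤ ∫⁻ ω, ⨆ i, ENNReal.ofReal (Real.exp (l * Y i ω - m i)) ∂P₂ := by
  rcases isEmpty_or_nonempty ι with hι | hι
  · simp
  have hP₁ := hX.isProbabilityMeasure
  have hP₂ := hY.isProbabilityMeasure
  rw [lintegral_iSup_exp_eq (fun i => (hX.eval i).aemeasurable) hl,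
    lintegral_iSup_exp_eq (fun i => (hY.eval i).aemeasurable) hl]
  exact lintegral_mono fun t =>
    tsub_le_tsub_left (measure_forall_le_le_of_cov_le hX hY hX0 hY0 hvar hcov _) _

end Slepian

/-! ### Time change and comparison of the two functionals. -/

section Comparison

theorem exp_supDrifted {Ω : Type*} (H : ℝ) (B : ℝ≥0 → Ω → ℝ) (T : ℝ≥0∞) (a : ℝ) (ω : Ω) :
    EReal.exp (supDrifted H B T a ω) = ⨆ (t : ℝ≥0) (_ : (t : ℝ≥0∞) ≤ T),
      ENNReal.ofReal (Real.exp (√2 * B t ω - a * (t : ℝ) ^ (2 * H))) := by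
  rw [← EReal.expOrderIso_apply, supDrifted]
  simp only [map_iSup, EReal.expOrderIso_apply, EReal.exp_coe]

theorem continuous_ofReal_exp_drifted {H : ℝ} (hH : 0 < H) {f : ℝ≥0 → ℝ} (hf : Continuous f)
    (a : ℝ) : Continuous fun t : ℝ≥0 =>
      ENNReal.ofReal (Real.exp (√2 * f t - a * (t : ℝ) ^ (2 * H))) := by
  have : Continuous fun t : ℝ≥0 => (t : ℝ) ^ (2 * H) :=
    (Real.continuous_rpow_const (by positivity)).comp NNReal.continuous_coe
  exact ENNReal.continuous_ofReal.comp (by fun_prop)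

/-- The supremum of a continuous function over a set is the supremum over a dense subset. -/
theorem iSup_mem_eq_iSup_subtype_of_subset_closure {X : Type*} [TopologicalSpace X] {S D : Set X}
    {f : X → ℝ≥0∞} (hf : Continuous f) (hDS : D ⊆ S) (hS : S ⊆ closure D) :
    ⨆ t ∈ S, f t = ⨆ t : D, f t := by
  refine le_antisymm (iSup₂_le fun t ht => ?_) (iSup_le fun t => le_iSup₂_of_le t (hDS t.2) le_rfl)
  have : closure D ⊆ {x | f x ≤ ⨆ t : D, f t} :=
    closure_minimal (fun x hx => le_iSup (fun t : D => f t) ⟨x, hx⟩)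
      (isClosed_le hf continuous_const)
  exact this (hS ht)

/-- Superadditivity `t ^ h + d ^ h ≤ (t + d) ^ h` for `h ≥ 1`. With `p = 2 * H₁` this is the
covariance comparison for the time change. -/
theorem abs_sub_rpow_mul_le {h p : ℝ} (hh : 1 ≤ h) (hp : 0 ≤ p) (s t : ℝ≥0) :
    |(s : ℝ) - t| ^ (h * p) ≤ |((s ^ h : ℝ≥0) : ℝ) - (t ^ h : ℝ≥0)| ^ p := by
  wlog hst : t ≤ s generalizing s t
  · rw [abs_sub_comm, abs_sub_comm ((s ^ h : ℝ≥0) : ℝ)]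
    exact this t s (le_of_not_ge hst)
  obtain ⟨d, rfl⟩ := exists_add_of_le hst
  have hle : t ^ h + d ^ h ≤ (t + d) ^ h := NNReal.add_rpow_le_rpow_add t d hh
  have hle' : ((t ^ h : ℝ≥0) : ℝ) + ((d ^ h : ℝ≥0) : ℝ) ≤ (((t + d) ^ h : ℝ≥0) : ℝ) := by
    exact_mod_cast hle
  have e : |((t + d : ℝ≥0) : ℝ) - t| = d := by simp
  rw [e, Real.rpow_mul d.coe_nonneg]
  refine Real.rpow_le_rpow (by positivity) ?_ hp
  rw [← NNReal.coe_rpow]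
  exact (le_sub_iff_add_le'.2 hle').trans (le_abs_self _)

variable {Ω₁ Ω₂ : Type*} [MeasurableSpace Ω₁] [MeasurableSpace Ω₂] {P₁ : Measure Ω₁}
  {P₂ : Measure Ω₂} {H H₁ H₂ : ℝ} {B₁ : ℝ≥0 → Ω₁ → ℝ} {B₂ : ℝ≥0 → Ω₂ → ℝ}

/-- Path continuity reduces the supremum to a countable dense set, and monotone convergence along
its directed finite subsets takes the supremum out of the integral. -/
theorem piterbargFunctional_eq_iSup_finset (hH : 0 < H)
    (hB : IsFractionalBrownianMotion P₁ H B₁) {T : ℝ≥0∞} {D : Set ℝ≥0}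
    (hD : D.Countable) (hDT : ∀ t ∈ D, (t : ℝ≥0∞) ≤ T)
    (hTD : ∀ t : ℝ≥0, (t : ℝ≥0∞) ≤ T → t ∈ closure D) (a : ℝ) :
    piterbargFunctional P₁ H B₁ T a = ⨆ s : Finset D, ∫⁻ ω, ⨆ t : s,
      ENNReal.ofReal (Real.exp (√2 * B₁ t ω - a * ((t : ℝ≥0) : ℝ) ^ (2 * H))) ∂P₁ := by
  have : Countable D := hD.to_subtype
  have hm (t : ℝ≥0) : AEMeasurable (fun ω =>
      ENNReal.ofReal (Real.exp (√2 * B₁ t ω - a * (t : ℝ) ^ (2 * H)))) P₁ := by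
    have := hB.isGaussianProcess.aemeasurable t
    fun_prop
  rw [← lintegral_iSup_directed (fun s => .iSup fun t => hm _)]
  · refine lintegral_congr_ae ?_
    filter_upwards [hB.continuous_paths] with ω hω
    rw [exp_supDrifted]
    have := iSup_mem_eq_iSup_subtype_of_subset_closure (S := {t : ℝ≥0 | (t : ℝ≥0∞) ≤ T})
      (continuous_ofReal_exp_drifted hH hω a) hDT hTD
    simp only [Set.mem_ofPred_eq] at this
    rw [this, iSup_eq_iSup_finset]
    simp only [iSup_subtype]
  · refine Monotone.directed_le fun s s' hss ω => ?_
    exact iSup_le fun t => le_iSup_of_le (⟨t.1, hss t.2⟩ : s') le_rfl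

theorem piterbargFunctional_le (hH₁ : 0 < H₁) (hH₁₂ : H₁ ≤ H₂)
    (hB₁ : IsFractionalBrownianMotion P₁ H₁ B₁) (hB₂ : IsFractionalBrownianMotion P₂ H₂ B₂)
    {T T' : ℝ≥0∞} (hT : ∀ t : ℝ≥0, (t : ℝ≥0∞) ≤ T → ((t ^ (H₂ / H₁) : ℝ≥0) : ℝ≥0∞) ≤ T')
    (a : ℝ) : piterbargFunctional P₂ H₂ B₂ T a ≤ piterbargFunctional P₁ H₁ B₁ T' a := by
  have hh : 1 ≤ H₂ / H₁ := (one_le_div hH₁).2 hH₁₂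
  obtain ⟨D, hDT, hD, hTD⟩ := (TopologicalSpace.IsSeparable.of_separableSpace
    {t : ℝ≥0 | (t : ℝ≥0∞) ≤ T}).exists_countable_dense_subset
  rw [piterbargFunctional_eq_iSup_finset (hH₁.trans_le hH₁₂) hB₂ hD hDT hTD]
  refine iSup_le fun s => ?_
  have hpow (t : ℝ≥0) : (t : ℝ) ^ (2 * H₂) = ((t ^ (H₂ / H₁) : ℝ≥0) : ℝ) ^ (2 * H₁) := by
    rw [NNReal.coe_rpow, ← Real.rpow_mul t.coe_nonneg]
    congr 1; field_simp
  -- `B₂` is the more correlated family. Its finite maxima are bounded by those of `B₁` at the times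
  -- `t ^ (H₂ / H₁)`, which lie within the horizon `T'`; no density of these times is needed.
  refine (lintegral_iSup_exp_le_of_cov_le (P₂ := P₁)
    (Y := fun (t : s) => B₁ ((t : ℝ≥0) ^ (H₂ / H₁)))
    ((hB₂.isGaussianProcess.comp_right (Subtype.val : D → ℝ≥0)).hasGaussianLaw s)
    ((hB₁.isGaussianProcess.comp_right fun t : D => (t : ℝ≥0) ^ (H₂ / H₁)).hasGaussianLaw s)
    (fun t => hB₂.centered _) (fun t => hB₁.centered _) (fun t => ?_) (fun t t' => ?_)
    (by positivity) _).trans ?_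
  · change cov[B₂ t, B₂ t; P₂] = cov[B₁ _, B₁ _; P₁]
    rw [hB₁.covariance_eq, hB₂.covariance_eq, NNReal.abs_eq, NNReal.abs_eq, hpow, sub_self,
      sub_self, abs_zero, Real.zero_rpow (by linarith), Real.zero_rpow (by linarith)]
  · change cov[B₁ _, B₁ _; P₁] ≤ cov[B₂ t, B₂ t'; P₂]
    rw [hB₁.covariance_eq, hB₂.covariance_eq, NNReal.abs_eq, NNReal.abs_eq, NNReal.abs_eq,
      NNReal.abs_eq, hpow, hpow]
    have := abs_sub_rpow_mul_le (p := 2 * H₁) hh (by positivity) (t : ℝ≥0) (t' : ℝ≥0)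
    rw [show H₂ / H₁ * (2 * H₁) = 2 * H₂ by field_simp] at this
    linarith
  · refine lintegral_mono fun ω => ?_
    rw [exp_supDrifted]
    refine iSup_le fun t => ?_
    rw [hpow]
    exact le_iSup₂_of_le ((t : ℝ≥0) ^ (H₂ / H₁)) (hT _ (hDT t.1.2)) le_rfl

end Comparison

/-! ### Dyadic chaining bound for exponential moments of increments. -/

section Chaining

/-- Jensen's inequality for the exponential with geometric weights `(1 - r) r ^ m`. -/
theorem exp_sum_geometric_le {r : ℝ} (hr0 : 0 ≤ r) (hr1 : r ≤ 1) (y : ℕ → ℝ) (n : ℕ) :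
    Real.exp (∑ m ∈ Finset.range n, (1 - r) * r ^ m * y m)
      ≤ 1 + ∑ m ∈ Finset.range n, (1 - r) * r ^ m * Real.exp (y m) := by
  have hsum : r ^ n + ∑ m ∈ Finset.range n, (1 - r) * r ^ m = 1 := by
    rw [← Finset.mul_sum, mul_neg_geom_sum]; ring
  -- The first `n` weights leave mass `r ^ n`, placed at the point `0`, where the exponential is
  -- `1`.
  have := convexOn_exp.map_add_sum_le (t := Finset.range n) (w := fun m => (1 - r) * r ^ m)
    (p := y) (v := r ^ n) (q := 0)
    (fun m _ => mul_nonneg (sub_nonneg.2 hr1) (pow_nonneg hr0 m)) hsum (fun _ _ => trivial)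
    (pow_nonneg hr0 n) trivial
  simp only [smul_eq_mul, mul_zero, zero_add, Real.exp_zero, mul_one] at this
  linarith [pow_le_one₀ (n := n) hr0 hr1]

/-- The largest dyadic number of level `m` below `t`. -/
noncomputable def dyadicFloor (t : ℝ≥0) (m : ℕ) : ℝ≥0 := (⌊(t : ℝ) * 2 ^ m⌋₊ : ℝ≥0) / 2 ^ m

theorem tendsto_dyadicFloor (t : ℝ≥0) :
    Filter.Tendsto (dyadicFloor t) Filter.atTop (nhds t) := by
  rw [← NNReal.tendsto_coe]
  have := (tendsto_nat_floor_mul_div_atTop t.coe_nonneg).comp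
    (tendsto_pow_atTop_atTop_of_one_lt (one_lt_two : (1 : ℝ) < 2))
  refine this.congr fun m => ?_
  simp [dyadicFloor]

theorem dyadicFloor_zero {t : ℝ≥0} {k : ℕ} (h1 : k ≤ t) (h2 : t < k + 1) :
    dyadicFloor t 0 = k := by
  have : ⌊(t : ℝ)⌋₊ = k := (Nat.floor_eq_iff t.coe_nonneg).2 ⟨by exact_mod_cast h1,
    by exact_mod_cast h2⟩
  simp [dyadicFloor, this]

/-- The `i`-th increment of `f` of dyadic level `m` in the unit interval starting at `k`. -/
noncomputable def dyadicIncrement (f : ℝ≥0 → ℝ) (k m i : ℕ) : ℝ :=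
  f ((2 * (k * 2 ^ m + i) + 1 : ℕ) / 2 ^ (m + 1)) - f ((2 * (k * 2 ^ m + i) : ℕ) / 2 ^ (m + 1))

/-- Refining the grid either keeps the floor or moves it by one new half-step, so at level `m` only
`2 ^ m` nonzero candidates occur for all `t` in the unit interval. -/
theorem dyadicFloor_succ_increment (f : ℝ≥0 → ℝ) {t : ℝ≥0} {k : ℕ} (h1 : k ≤ t)
    (h2 : t < k + 1) (m : ℕ) :
    f (dyadicFloor t (m + 1)) - f (dyadicFloor t m) = 0 ∨
      ∃ i ∈ Finset.range (2 ^ m),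
        f (dyadicFloor t (m + 1)) - f (dyadicFloor t m) = dyadicIncrement f k m i := by
  have h1' : (k : ℝ) ≤ t := by exact_mod_cast h1
  have h2' : (t : ℝ) < k + 1 := by exact_mod_cast h2
  set j := ⌊(t : ℝ) * 2 ^ m⌋₊ with hj
  have hjle : (j : ℝ) ≤ t * 2 ^ m := Nat.floor_le (by positivity)
  have hjlt : (t : ℝ) * 2 ^ m < j + 1 := Nat.lt_floor_add_one _
  have e0 : dyadicFloor t m = ((2 * j : ℕ) : ℝ≥0) / 2 ^ (m + 1) := by
    rw [dyadicFloor, ← hj, pow_succ']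
    push_cast
    rw [mul_div_mul_left _ _ two_ne_zero]
  have hcases : ⌊(t : ℝ) * 2 ^ (m + 1)⌋₊ = 2 * j ∨ ⌊(t : ℝ) * 2 ^ (m + 1)⌋₊ = 2 * j + 1 := by
    have a1 : 2 * j ≤ ⌊(t : ℝ) * 2 ^ (m + 1)⌋₊ := by
      refine Nat.le_floor ?_
      push_cast
      rw [pow_succ]; linarith
    have a2 : ⌊(t : ℝ) * 2 ^ (m + 1)⌋₊ < 2 * j + 2 := by
      rw [Nat.floor_lt (by positivity)]
      push_cast
      rw [pow_succ]; linarith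
    omega
  rcases hcases with h | h
  · left
    rw [e0, dyadicFloor, h, sub_self]
  · right
    have b1 : k * 2 ^ m ≤ j := by
      refine Nat.le_floor ?_
      push_cast
      gcongr
    have b2 : j < k * 2 ^ m + 2 ^ m := by
      rw [hj, Nat.floor_lt (by positivity)]
      push_cast
      nlinarith [pow_pos (two_pos : (0 : ℝ) < 2) m]
    refine ⟨j - k * 2 ^ m, Finset.mem_range.2 (by omega), ?_⟩
    rw [e0, dyadicFloor, h, dyadicIncrement, Nat.add_sub_cancel' b1]

/-- The chaining bound for the exponential of the increments of a function from `k`. -/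
noncomputable def chainingBound (r l : ℝ) (k : ℕ) (f : ℝ≥0 → ℝ) : ℝ≥0∞ :=
  ENNReal.ofReal (Real.exp (∑' m : ℕ, (1 - r) * r ^ m * (m * Real.log 2))) *
    (1 + ∑' m : ℕ, ENNReal.ofReal ((1 - r) * r ^ m) *
      (1 + ∑ i ∈ Finset.range (2 ^ m), ENNReal.ofReal ((2 ^ m)⁻¹) * ENNReal.ofReal
        (Real.exp (l / ((1 - r) * r ^ m) * dyadicIncrement f k m i))))

/-- The increment telescopes over dyadic levels, Jensen's inequality separates the levels, and at
each level the unknown increment is replaced by the sum over all candidates. The bound no longer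
depends on `t`. -/
theorem ofReal_exp_increment_le_chainingBound {r l : ℝ} (hr0 : 0 < r) (hr1 : r < 1)
    {f : ℝ≥0 → ℝ} (hf : Continuous f) {t : ℝ≥0} {k : ℕ} (h1 : k ≤ t) (h2 : t < k + 1) :
    ENNReal.ofReal (Real.exp (l * (f t - f k))) ≤ chainingBound r l k f := by
  have hlim : Filter.Tendsto (fun n => ENNReal.ofReal (Real.exp (l * (f (dyadicFloor t n) - f k))))
      Filter.atTop (nhds (ENNReal.ofReal (Real.exp (l * (f t - f k))))) := by
    have hc : Continuous fun s => ENNReal.ofReal (Real.exp (l * (f s - f k))) :=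
      ENNReal.continuous_ofReal.comp (by fun_prop)
    exact (hc.tendsto t).comp (tendsto_dyadicFloor t)
  refine le_of_tendsto' hlim fun n => ?_
  set p : ℕ → ℝ := fun m => (1 - r) * r ^ m with hp
  have hp0 (m) : 0 < p m := mul_pos (sub_pos.2 hr1) (pow_pos hr0 m)
  set d : ℕ → ℝ := fun m => f (dyadicFloor t (m + 1)) - f (dyadicFloor t m) with hd
  have hdsum : f (dyadicFloor t n) - f k = ∑ m ∈ Finset.range n, d m := by
    rw [Finset.sum_range_sub (fun m => f (dyadicFloor t m)), dyadicFloor_zero h1 h2]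
  have hlog : 0 ≤ Real.log 2 := Real.log_nonneg one_le_two
  have hsummable : Summable fun m : ℕ => p m * (m * Real.log 2) := by
    have := summable_pow_mul_geometric_of_norm_lt_one 1
      (show ‖r‖ < 1 by rwa [Real.norm_eq_abs, abs_of_pos hr0])
    refine (this.mul_left ((1 - r) * Real.log 2)).congr fun m => ?_
    simp only [hp, pow_one]; ring
  -- Subtracting `m * log 2` yields the factor `(2 ^ m)⁻¹` that offsets the `2 ^ m` candidates; the
  -- weighted sum of these terms converges and becomes the prefactor.
  have e1 : l * (f (dyadicFloor t n) - f k) = ∑ m ∈ Finset.range n, p m * (m * Real.log 2)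
      + ∑ m ∈ Finset.range n, p m * (l / p m * d m - m * Real.log 2) := by
    rw [hdsum, ← Finset.sum_add_distrib, Finset.mul_sum]
    refine Finset.sum_congr rfl fun m _ => ?_
    have := (hp0 m).ne'
    field_simp
    ring
  have e2 : ∑ m ∈ Finset.range n, p m * (m * Real.log 2) ≤ ∑' m, p m * (m * Real.log 2) :=
    hsummable.sum_le_tsum _ fun m _ => by have := hp0 m; positivity
  have hterm (m) : ENNReal.ofReal (p m * Real.exp (l / p m * d m - m * Real.log 2))
      ≤ ENNReal.ofReal (p m) * (1 + ∑ i ∈ Finset.range (2 ^ m), ENNReal.ofReal ((2 ^ m)⁻¹) *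
        ENNReal.ofReal (Real.exp (l / p m * dyadicIncrement f k m i))) := by
    rw [ENNReal.ofReal_mul (hp0 m).le]
    gcongr
    have e3 : Real.exp (m * Real.log 2) = 2 ^ m := by
      rw [Real.exp_nat_mul, Real.exp_log two_pos]
    rw [Real.exp_sub, e3, div_eq_inv_mul, ENNReal.ofReal_mul (by positivity)]
    rcases dyadicFloor_succ_increment f h1 h2 m with h | ⟨i, hi, h⟩
    · refine le_add_right ?_
      simp only [hd, h, mul_zero, Real.exp_zero, ENNReal.ofReal_one, mul_one]
      rw [ENNReal.ofReal_le_one]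
      exact inv_le_one_of_one_le₀ (one_le_pow₀ one_le_two)
    · refine le_add_left ?_
      simp only [hd, h]
      exact Finset.single_le_sum (f := fun i => ENNReal.ofReal ((2 ^ m)⁻¹) *
        ENNReal.ofReal (Real.exp (l / p m * dyadicIncrement f k m i))) (fun _ _ => zero_le) hi
  rw [e1, Real.exp_add, ENNReal.ofReal_mul (Real.exp_pos _).le, chainingBound]
  refine mul_le_mul' (ENNReal.ofReal_le_ofReal (Real.exp_le_exp.2 e2)) ?_
  refine (ENNReal.ofReal_le_ofReal (exp_sum_geometric_le hr0.le hr1.le _ n)).trans ?_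
  rw [ENNReal.ofReal_add zero_le_one (Finset.sum_nonneg fun m _ =>
    mul_nonneg (hp0 m).le (Real.exp_pos _).le), ENNReal.ofReal_one,
    ENNReal.ofReal_sum_of_nonneg fun m _ => mul_nonneg (hp0 m).le (Real.exp_pos _).le]
  gcongr
  exact (Finset.sum_le_sum fun m _ => hterm m).trans (ENNReal.sum_le_tsum _)

variable {Ω : Type*} [MeasurableSpace Ω] {P : Measure Ω} {H : ℝ} {B : ℝ≥0 → Ω → ℝ}

theorem aemeasurable_exp_dyadicIncrement (hB : ∀ t, AEMeasurable (B t) P) (x : ℝ) (k m i : ℕ) :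
    AEMeasurable (fun ω => ENNReal.ofReal (Real.exp (x *
      dyadicIncrement (fun t => B t ω) k m i))) P := by
    simp only [dyadicIncrement]
    have h1 := hB ((2 * (k * 2 ^ m + i) + 1 : ℕ) / 2 ^ (m + 1))
    have h2 := hB ((2 * (k * 2 ^ m + i) : ℕ) / 2 ^ (m + 1))
    exact (Real.measurable_exp.comp_aemeasurable ((h1.sub h2).const_mul _)).ennreal_ofReal

theorem aemeasurable_chainingBound_term (hB : ∀ t, AEMeasurable (B t) P) (r l : ℝ) (k m : ℕ) :
    AEMeasurable (fun ω => ENNReal.ofReal ((1 - r) * r ^ m) *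
      (1 + ∑ i ∈ Finset.range (2 ^ m), ENNReal.ofReal ((2 ^ m)⁻¹) * ENNReal.ofReal
        (Real.exp (l / ((1 - r) * r ^ m) * dyadicIncrement (fun t => B t ω) k m i)))) P :=
    (aemeasurable_const.add (Finset.aemeasurable_fun_sum _ fun i _ =>
      (aemeasurable_exp_dyadicIncrement hB _ k m i).const_mul _)).const_mul _

theorem aemeasurable_chainingBound (hB : ∀ t, AEMeasurable (B t) P) (r l : ℝ) (k : ℕ) :
    AEMeasurable (fun ω => chainingBound r l k fun t => B t ω) P :=
  (aemeasurable_const.add (AEMeasurable.tsum fun m =>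
    aemeasurable_chainingBound_term hB r l k m)).const_mul _

theorem lintegral_ofReal_exp_mul_of_hasGaussianLaw {U : Ω → ℝ} (hU : HasGaussianLaw U P)
    (h0 : ∫ ω, U ω ∂P = 0) (x : ℝ) :
    ∫⁻ ω, ENNReal.ofReal (Real.exp (x * U ω)) ∂P
      = ENNReal.ofReal (Real.exp (x ^ 2 * Var[U; P] / 2)) := by
  have hlaw := hU.map_eq_gaussianReal
  rw [h0] at hlaw
  have hm := mgf_gaussianReal hlaw x
  have hint : Integrable (fun ω => Real.exp (x * U ω)) P := by
    have := integrable_exp_mul_gaussianReal (μ := 0) (v := Var[U; P].toNNReal) x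
    rw [← hlaw] at this
    exact this.comp_aemeasurable hU.aemeasurable
  rw [← ofReal_integral_eq_lintegral_ofReal hint (ae_of_all _ fun _ => (Real.exp_pos _).le)]
  change ENNReal.ofReal (mgf U P x) = _
  rw [hm, Real.coe_toNNReal _ (variance_nonneg _ _)]
  congr 2; ring

theorem IsFractionalBrownianMotion.variance_eq (hB : IsFractionalBrownianMotion P H B)
    (hH : 0 < H) (t : ℝ≥0) : Var[B t; P] = (t : ℝ) ^ (2 * H) := by
  rw [← covariance_self (hB.isGaussianProcess.aemeasurable t), hB.covariance_eq, sub_self,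
    abs_zero, Real.zero_rpow (by positivity), NNReal.abs_eq]
  ring

theorem IsFractionalBrownianMotion.lintegral_exp_increment
    (hB : IsFractionalBrownianMotion P H B) (hH : 0 < H) (s t : ℝ≥0) (x : ℝ) :
    ∫⁻ ω, ENNReal.ofReal (Real.exp (x * (B t ω - B s ω))) ∂P
      = ENNReal.ofReal (Real.exp (x ^ 2 * |(t : ℝ) - s| ^ (2 * H) / 2)) := by
  have := hB.isGaussianProcess.isProbabilityMeasure
  have hG := hB.isGaussianProcess.hasGaussianLaw_eval
  rw [lintegral_ofReal_exp_mul_of_hasGaussianLaw (U := fun ω => B t ω - B s ω)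
    hB.isGaussianProcess.hasGaussianLaw_fun_sub]
  · rw [variance_fun_sub (hG t).memLp_two (hG s).memLp_two, hB.variance_eq hH, hB.variance_eq hH,
      hB.covariance_eq, NNReal.abs_eq, NNReal.abs_eq]
    congr 3; ring
  · rw [integral_sub (hG t).integrable (hG s).integrable, hB.centered, hB.centered, sub_zero]

/-- The expectations of the chaining bounds of fractional Brownian motion are finite, uniformly
in the starting point. -/
theorem IsFractionalBrownianMotion.exists_lintegral_chainingBound_le
    (hB : IsFractionalBrownianMotion P H B) (hH : 0 < H) (l : ℝ) :
    ∃ C : ℝ≥0∞, C < ∞ ∧ ∀ k : ℕ,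
      ∫⁻ ω, chainingBound ((2 : ℝ) ^ (-H)) l k (fun t => B t ω) ∂P ≤ C := by
  have := hB.isGaussianProcess.isProbabilityMeasure
  set r : ℝ := (2 : ℝ) ^ (-H) with hr
  have hr0 : 0 < r := by positivity
  have hr1 : r < 1 := Real.rpow_lt_one_of_one_lt_of_neg one_lt_two (by linarith)
  have hBm (t : ℝ≥0) : AEMeasurable (B t) P := hB.isGaussianProcess.aemeasurable t
  -- With `r = 2 ^ (-H)`, a level-`m` increment has variance `r ^ (2 * (m + 1))`, which cancels the
  -- `r ^ m` in the multiplier `l / ((1 - r) * r ^ m)`: its exponential moment is `E` at every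
  -- level.
  set E : ℝ := Real.exp (l ^ 2 * r ^ 2 / (2 * (1 - r) ^ 2)) with hE
  refine ⟨ENNReal.ofReal (Real.exp (∑' m : ℕ, (1 - r) * r ^ m * (m * Real.log 2))) *
    (1 + (1 + ENNReal.ofReal E)), by finiteness, fun k => ?_⟩
  have hinc (m i : ℕ) : ∫⁻ ω, ENNReal.ofReal (Real.exp (l / ((1 - r) * r ^ m) *
      dyadicIncrement (fun t => B t ω) k m i)) ∂P = ENNReal.ofReal E := by
    simp only [dyadicIncrement]
    rw [hB.lintegral_exp_increment hH]
    congr 2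
    have e1 : |(((2 * (k * 2 ^ m + i) + 1 : ℕ) / 2 ^ (m + 1) : ℝ≥0) : ℝ)
        - (((2 * (k * 2 ^ m + i) : ℕ) / 2 ^ (m + 1) : ℝ≥0) : ℝ)| = (2 : ℝ) ^ (-(m + 1 : ℝ)) := by
      push_cast
      rw [← sub_div, add_sub_cancel_left, abs_of_pos (by positivity), Real.rpow_neg two_pos.le,
        ← Nat.cast_add_one, Real.rpow_natCast, one_div]
    have e2 : ((2 : ℝ) ^ (-(m + 1 : ℝ))) ^ (2 * H) = (r ^ (m + 1)) ^ 2 := by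
      rw [hr, ← Real.rpow_natCast, ← Real.rpow_natCast, ← Real.rpow_mul two_pos.le,
        ← Real.rpow_mul two_pos.le, ← Real.rpow_mul two_pos.le]
      congr 1; push_cast; ring
    rw [e1, e2]
    have : 1 - r ≠ 0 := (sub_pos.2 hr1).ne'
    field_simp
    ring
  simp only [chainingBound]
  rw [lintegral_const_mul' _ _ ENNReal.ofReal_ne_top,
    lintegral_add_left' aemeasurable_const, lintegral_one, measure_univ, lintegral_tsum (aemeasurable_chainingBound_term hBm r l k)]
  gcongr
  have hterm (m : ℕ) : ∫⁻ ω, ENNReal.ofReal ((1 - r) * r ^ m) *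
      (1 + ∑ i ∈ Finset.range (2 ^ m), ENNReal.ofReal ((2 ^ m)⁻¹) * ENNReal.ofReal
        (Real.exp (l / ((1 - r) * r ^ m) * dyadicIncrement (fun t => B t ω) k m i))) ∂P
      = ENNReal.ofReal ((1 - r) * r ^ m) * (1 + ENNReal.ofReal E) := by
    rw [lintegral_const_mul' _ _ ENNReal.ofReal_ne_top, lintegral_add_left' aemeasurable_const,
      lintegral_one, measure_univ, lintegral_finsetSum' _ fun i _ => (aemeasurable_exp_dyadicIncrement hBm _ k m i).const_mul _]
    congr 2
    simp_rw [lintegral_const_mul' _ _ ENNReal.ofReal_ne_top, hinc]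
    rw [Finset.sum_const, Finset.card_range, nsmul_eq_mul, ← mul_assoc,
      ← ENNReal.ofReal_natCast, ← ENNReal.ofReal_mul (by positivity)]
    push_cast
    rw [mul_inv_cancel₀ (by positivity), ENNReal.ofReal_one, one_mul]
  simp_rw [hterm]
  rw [ENNReal.tsum_mul_right, ← ENNReal.ofReal_tsum_of_nonneg
    (fun m => mul_nonneg (sub_nonneg.2 hr1.le) (pow_nonneg hr0.le m))
    ((summable_geometric_of_lt_one hr0.le hr1).mul_left _), tsum_mul_left,
    tsum_geometric_of_lt_one hr0.le hr1, mul_inv_cancel₀ (sub_pos.2 hr1).ne']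
  simp

end Chaining

/-! ### Finiteness of the functionals. -/

section Finiteness

variable {Ω : Type*} [MeasurableSpace Ω] {P : Measure Ω} {H : ℝ} {B : ℝ≥0 → Ω → ℝ}

theorem summable_exp_neg_mul_natCast_rpow {ε s : ℝ} (hε : 0 < ε) (hs : 0 < s) :
    Summable fun k : ℕ => Real.exp (-ε * (k : ℝ) ^ s) := by
  -- The power `-2 / s`, evaluated at `k ^ s`, becomes the summable `k ^ (-2)`.
  have h1 := (isLittleO_exp_neg_mul_rpow_atTop hε (-2 / s)).isBigO.comp_tendsto
    ((tendsto_rpow_atTop hs).comp tendsto_natCast_atTop_atTop)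
  refine summable_of_isBigO_nat (g := fun k : ℕ => (k : ℝ) ^ (-2 : ℝ))
    (Real.summable_nat_rpow.2 (by norm_num)) (h1.trans (Asymptotics.isBigO_of_le _ fun k => ?_))
  simp only [Function.comp]
  rw [← Real.rpow_mul (Nat.cast_nonneg k), mul_div_cancel₀ _ hs.ne']

/-- `x + y` is a convex combination of the two exponents on the right, hence at most their maximum.
This replaces Hölder's inequality in separating `B k` from the increment. -/
theorem exp_add_le_exp_mul_add_exp_mul {ε : ℝ} (hε : 0 < ε) (x y : ℝ) :
    Real.exp (x + y) ≤ Real.exp ((1 + ε) * x) + Real.exp ((1 + ε) / ε * y) := by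
  have e : x + y = 1 / (1 + ε) * ((1 + ε) * x) + ε / (1 + ε) * ((1 + ε) / ε * y) := by
    field_simp
  set u := (1 + ε) * x
  set v := (1 + ε) / ε * y
  have h : x + y ≤ max u v := by
    calc x + y ≤ 1 / (1 + ε) * max u v + ε / (1 + ε) * max u v := by
          rw [e]; gcongr <;> simp
      _ = max u v := by field_simp
  rcases max_choice u v with hm | hm <;> rw [hm] at h
  · exact (Real.exp_le_exp.2 h).trans (le_add_of_nonneg_right (Real.exp_pos _).le)
  · exact (Real.exp_le_exp.2 h).trans (le_add_of_nonneg_left (Real.exp_pos _).le)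

/-- The drift is lowered to its value at `k` and shared: `1 + 2 * ε` for the value at `k`, `ε` for
the increment. The exponent `1 + ε` on the first stays near `1`; the large exponent `(1 + ε) / ε`
falls on the increment. -/
theorem ofReal_exp_drifted_le {H ε : ℝ} (hH : 0 < H) (hε : 0 < ε) {f : ℝ≥0 → ℝ}
    (hf : Continuous f) {t : ℝ≥0} {k : ℕ} (h1 : k ≤ t) (h2 : t < k + 1) :
    ENNReal.ofReal (Real.exp (√2 * f t - (1 + 3 * ε) * (t : ℝ) ^ (2 * H)))
      ≤ ENNReal.ofReal (Real.exp (-((1 + ε) * (1 + 2 * ε) * (k : ℝ) ^ (2 * H)))) *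
          ENNReal.ofReal (Real.exp ((1 + ε) * √2 * f k))
        + ENNReal.ofReal (Real.exp (-((1 + ε) * (k : ℝ) ^ (2 * H)))) *
          chainingBound ((2 : ℝ) ^ (-H)) ((1 + ε) / ε * √2) k f := by
  have hr1 : (2 : ℝ) ^ (-H) < 1 := Real.rpow_lt_one_of_one_lt_of_neg one_lt_two (by linarith)
  have hkt : (k : ℝ) ^ (2 * H) ≤ (t : ℝ) ^ (2 * H) :=
    Real.rpow_le_rpow (Nat.cast_nonneg k) (by exact_mod_cast h1) (by positivity)
  have hle : Real.exp (√2 * f t - (1 + 3 * ε) * (t : ℝ) ^ (2 * H))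
      ≤ Real.exp (-((1 + ε) * (1 + 2 * ε) * (k : ℝ) ^ (2 * H))) *
          Real.exp ((1 + ε) * √2 * f k) + Real.exp (-((1 + ε) * (k : ℝ) ^ (2 * H))) *
          Real.exp ((1 + ε) / ε * √2 * (f t - f k)) := by
    have h3 := exp_add_le_exp_mul_add_exp_mul hε
      (√2 * f k - (1 + 2 * ε) * (k : ℝ) ^ (2 * H)) (√2 * (f t - f k) - ε * (k : ℝ) ^ (2 * H))
    rw [← Real.exp_add, ← Real.exp_add]
    refine (Real.exp_le_exp.2 ?_).trans (h3.trans_eq ?_)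
    · nlinarith
    · congr 2
      · ring
      · field_simp; ring
  refine (ENNReal.ofReal_le_ofReal hle).trans ?_
  rw [ENNReal.ofReal_add (by positivity) (by positivity), ENNReal.ofReal_mul (Real.exp_pos _).le,
    ENNReal.ofReal_mul (Real.exp_pos _).le]
  gcongr
  exact ofReal_exp_increment_le_chainingBound (by positivity) hr1 hf h1 h2

theorem piterbargFunctional_top_lt_top (hH : 0 < H) (hB : IsFractionalBrownianMotion P H B)
    {a : ℝ} (ha : 1 < a) : piterbargFunctional P H B ∞ a < ∞ := by
  obtain ⟨ε, hε, rfl⟩ : ∃ ε : ℝ, 0 < ε ∧ a = 1 + 3 * ε :=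
    ⟨(a - 1) / 3, by linarith, by ring⟩
  have hBm (t : ℝ≥0) : AEMeasurable (B t) P := hB.isGaussianProcess.aemeasurable t
  obtain ⟨C, hC, hCk⟩ := hB.exists_lintegral_chainingBound_le hH ((1 + ε) / ε * √2)
  set S : ℕ → Ω → ℝ≥0∞ := fun k ω =>
    ENNReal.ofReal (Real.exp (-((1 + ε) * (1 + 2 * ε) * (k : ℝ) ^ (2 * H)))) *
        ENNReal.ofReal (Real.exp ((1 + ε) * √2 * B k ω))
      + ENNReal.ofReal (Real.exp (-((1 + ε) * (k : ℝ) ^ (2 * H)))) *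
        chainingBound ((2 : ℝ) ^ (-H)) ((1 + ε) / ε * √2) k (fun t => B t ω) with hS
  have hm1 (k : ℕ) : AEMeasurable (fun ω =>
      ENNReal.ofReal (Real.exp (-((1 + ε) * (1 + 2 * ε) * (k : ℝ) ^ (2 * H)))) *
        ENNReal.ofReal (Real.exp ((1 + ε) * √2 * B k ω))) P := by
    have := hBm k
    fun_prop
  have hSm (k : ℕ) : AEMeasurable (S k) P :=
    (hm1 k).add ((aemeasurable_chainingBound hBm _ _ k).const_mul _)
  have hle : piterbargFunctional P H B ∞ (1 + 3 * ε) ≤ ∫⁻ ω, ∑' k, S k ω ∂P := by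
    refine lintegral_mono_ae ?_
    filter_upwards [hB.continuous_paths] with ω hω
    rw [exp_supDrifted]
    refine iSup₂_le fun t _ => ?_
    exact (ofReal_exp_drifted_le hH hε hω (Nat.floor_le zero_le) (Nat.lt_floor_add_one t)).trans
      (ENNReal.le_tsum (f := fun k => S k ω) ⌊t⌋₊)
  have hint (k : ℕ) : ∫⁻ ω, S k ω ∂P
      ≤ ENNReal.ofReal (Real.exp (-ε * (k : ℝ) ^ (2 * H))) * (1 + C) := by
    have hk : 0 ≤ (k : ℝ) ^ (2 * H) := by positivity
    simp only [hS]
    rw [lintegral_add_left' (hm1 k), lintegral_const_mul' _ _ ENNReal.ofReal_ne_top,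
      lintegral_const_mul' _ _ ENNReal.ofReal_ne_top, mul_add _ (1 : ℝ≥0∞) C, mul_one,
      lintegral_ofReal_exp_mul_of_hasGaussianLaw (hB.isGaussianProcess.hasGaussianLaw_eval _)
        (hB.centered _), hB.variance_eq hH, ← ENNReal.ofReal_mul (Real.exp_pos _).le,
      ← Real.exp_add, NNReal.coe_natCast, mul_pow, Real.sq_sqrt two_pos.le]
    refine add_le_add (ENNReal.ofReal_le_ofReal (Real.exp_le_exp.2 ?_))
      (mul_le_mul' (ENNReal.ofReal_le_ofReal (Real.exp_le_exp.2 ?_)) (hCk k))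
    -- The Gaussian moment contributes `(1 + ε) ^ 2` and the drift `-(1 + ε) * (1 + 2 * ε)`, which
    -- leaves `-ε * (1 + ε) ≤ -ε`.
    · nlinarith [mul_nonneg (sq_nonneg ε) hk]
    · nlinarith
  refine hle.trans_lt ?_
  rw [lintegral_tsum hSm]
  refine (ENNReal.tsum_le_tsum hint).trans_lt ?_
  rw [ENNReal.tsum_mul_right]
  have hsum : ∑' k : ℕ, ENNReal.ofReal (Real.exp (-ε * (k : ℝ) ^ (2 * H))) ≠ ∞ :=
    (summable_exp_neg_mul_natCast_rpow hε (by positivity)).tsum_ofReal_ne_top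
  exact ENNReal.mul_lt_top hsum.lt_top (by finiteness)

/-- On a bounded horizon, changing the drift coefficient costs only a constant factor, so any `a`
reduces to the coefficient `2 > 1` on `[0, ∞)`. -/
theorem piterbargFunctional_coe_lt_top (hH : 0 < H) (hB : IsFractionalBrownianMotion P H B)
    (T : ℝ≥0) (a : ℝ) : piterbargFunctional P H B T a < ∞ := by
  have hle : piterbargFunctional P H B T a
      ≤ ENNReal.ofReal (Real.exp (|2 - a| * (T : ℝ) ^ (2 * H))) *
        piterbargFunctional P H B ∞ 2 := by
    rw [piterbargFunctional, piterbargFunctional,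
      ← lintegral_const_mul' _ _ ENNReal.ofReal_ne_top]
    refine lintegral_mono fun ω => ?_
    rw [exp_supDrifted, exp_supDrifted]
    refine iSup₂_le fun t ht => ?_
    have htT : (t : ℝ) ^ (2 * H) ≤ (T : ℝ) ^ (2 * H) :=
      Real.rpow_le_rpow t.coe_nonneg (by exact_mod_cast ht) (by positivity)
    calc ENNReal.ofReal (Real.exp (√2 * B t ω - a * (t : ℝ) ^ (2 * H)))
        ≤ ENNReal.ofReal (Real.exp (|2 - a| * (T : ℝ) ^ (2 * H))) *
          ENNReal.ofReal (Real.exp (√2 * B t ω - 2 * (t : ℝ) ^ (2 * H))) := by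
          rw [← ENNReal.ofReal_mul (Real.exp_pos _).le, ← Real.exp_add]
          refine ENNReal.ofReal_le_ofReal (Real.exp_le_exp.2 ?_)
          have h0 : 0 ≤ (t : ℝ) ^ (2 * H) := by positivity
          have h1 := mul_le_mul_of_nonneg_left htT (abs_nonneg (2 - a))
          have h2 := mul_le_mul_of_nonneg_right (le_abs_self (2 - a)) h0
          linarith
      _ ≤ _ := by
          gcongr
          exact le_iSup₂ (f := fun (t : ℝ≥0) (_ : (t : ℝ≥0∞) ≤ ∞) =>
            ENNReal.ofReal (Real.exp (√2 * B t ω - 2 * (t : ℝ) ^ (2 * H)))) t le_top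
  exact hle.trans_lt (ENNReal.mul_lt_top ENNReal.ofReal_lt_top
    (piterbargFunctional_top_lt_top hH hB one_lt_two))

end Finiteness

theorem mainTheorem4
    {Ω₁ Ω₂ : Type*} [MeasurableSpace Ω₁] [MeasurableSpace Ω₂]
    (P₁ : Measure Ω₁) (P₂ : Measure Ω₂) [IsProbabilityMeasure P₁] [IsProbabilityMeasure P₂]
    (H₁ H₂ : ℝ) (hH₁ : 0 < H₁) (hH₁₂ : H₁ < H₂) (hH₂ : H₂ < 1)
    (B₁ : ℝ≥0 → Ω₁ → ℝ) (B₂ : ℝ≥0 → Ω₂ → ℝ)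
    (hB₁ : IsFractionalBrownianMotion P₁ H₁ B₁) (hB₂ : IsFractionalBrownianMotion P₂ H₂ B₂) :
    (∀ (a : ℝ) (T : ℝ≥0), 0 < T →
      piterbargFunctional P₂ H₂ B₂ (T : ℝ≥0∞) a
          ≤ piterbargFunctional P₁ H₁ B₁ ((T ^ (H₂ / H₁) : ℝ≥0) : ℝ≥0∞) a ∧
        piterbargFunctional P₁ H₁ B₁ ((T ^ (H₂ / H₁) : ℝ≥0) : ℝ≥0∞) a < ∞) ∧
    (∀ a : ℝ, 1 < a →
      piterbargFunctional P₂ H₂ B₂ ∞ a ≤ piterbargFunctional P₁ H₁ B₁ ∞ a ∧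
        piterbargFunctional P₁ H₁ B₁ ∞ a < ∞) := by
  refine ⟨fun a T _ => ⟨?_, piterbargFunctional_coe_lt_top hH₁ hB₁ _ a⟩,
    fun a ha => ⟨?_, piterbargFunctional_top_lt_top hH₁ hB₁ ha⟩⟩
  · refine piterbargFunctional_le hH₁ hH₁₂.le hB₁ hB₂ (fun t ht => ?_) a
    have hh : 0 ≤ H₂ / H₁ := div_nonneg (hH₁.trans hH₁₂).le hH₁.le
    exact ENNReal.coe_le_coe.2 (NNReal.rpow_le_rpow (ENNReal.coe_le_coe.1 ht) hh)
  · exact piterbargFunctional_le hH₁ hH₁₂.le hB₁ hB₂ (fun t _ => le_top) a
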